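/- Let $k$ be a commutative ring and let $G$ be a smooth affine algebraic group scheme over $k$, with coordinate Hopf algebra $k[G]$, comultiplication $\Delta$ and counit $\epsilon$. A $G$-module is a $k$-module $V$ with a coassociative and counital $k$-linear coaction $\Delta_V : V \to V\otimes_k k[G]$; a homomorphism of $G$-modules is a $k$-linear map compatible with the coactions; and $V^G=\{v\in V : \Delta_V(v)=v\otimes 1\}$, with trivial $G$-action. Let $H^1(G,V)=\ker\partial_1/\operatorname{im}\partial_0$ be the first Hochschild cohomology group, where $\partial_0(v)=\Delta_V(v)-v\otimes 1$ and $\partial_1(v\otimes f)=\Delta_V(v)\otimes f-v\otimes\Delta(f)+v\otimes f\otimes 1$. The group $G$ is linearly reductive if $H^1(G,V)=0$ for every $G$-module $V$. A Reynolds operator for $V$ is a homomorphism of $G$-modules $\mathcal R_V: V\to V^G$ with image $V^G$ and $\mathcal R_V|_{V^G}=\mathrm{id}$. A functorial Reynolds operator for $G$ is a choice of a Reynolds operator $\mathcal R_V$ for every $G$-module $V$ such that $\varphi\circ\mathcal R_V=\mathcal R_W\circ\varphi$ for every homomorphism of $G$-modules $\varphi:V\to W$. (a) If $G$ has a functorial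 Reynolds operator, then $G$ is linearly reductive. (b) If $k$ is a Dedekind domain and $G$ is linearly reductive, then $G$ has a functorial Reynolds operator. Moreover, the constants $k\cdot 1\subseteq k[G]$ then have a $k$-module complement $P$ in $k[G]$ that is $G$-stable under both left and right translation, i.e. $\Delta(P)$ lies in the image of $P\otimes_k k[G]$ and in the image of $k[G]\otimes_k P$ in $k[G]\otimes_k k[G]$. -/

import Mathlib

open scoped TensorProduct

universe u

/-!
An affine group scheme `G` over a commutative ring `k` is given by its coordinate ring `A = k[G]`,
a commutative Hopf algebra over `k`; a `G`-module is a `k`-module `V` with a right coaction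
`V → V ⊗ k[G]`.
-/

/-- A `G`-module structure on the `k`-module `V`, where `A = k[G]`: a coassociative and counital
comodule map `Δ_V : V → V ⊗ k[G]`. -/
structure GModuleStructure (k A V : Type u) [CommRing k] [CommRing A] [HopfAlgebra k A]
    [AddCommGroup V] [Module k V] where
  coact : V →ₗ[k] V ⊗[k] A
  coassoc : (TensorProduct.assoc k V A A).toLinearMap ∘ₗ coact.rTensor A ∘ₗ coact =
    (Coalgebra.comul (R := k) (A := A)).lTensor V ∘ₗ coact
  counital : (TensorProduct.rid k V).toLinearMap ∘ₗ
    (Coalgebra.counit (R := k) (A := A)).lTensor V ∘ₗ coact = LinearMap.id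

namespace GModuleStructure

section

variable {k A V W : Type u} [CommRing k] [CommRing A] [HopfAlgebra k A]
  [AddCommGroup V] [Module k V] [AddCommGroup W] [Module k W]

/-- The map `v ↦ v ⊗ 1`. -/
noncomputable def tensorOne (k A V : Type u) [CommRing k] [CommRing A] [HopfAlgebra k A]
    [AddCommGroup V] [Module k V] : V →ₗ[k] V ⊗[k] A :=
  (TensorProduct.mk k V A).flip 1

@[simp]
theorem tensorOne_apply (v : V) : tensorOne k A V v = v ⊗ₜ[k] (1 : A) := rfl

/-- The trivial `G`-module structure on `V`. -/
noncomputable def trivial (k A V : Type u) [CommRing k] [CommRing A] [HopfAlgebra k A]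
    [AddCommGroup V] [Module k V] : GModuleStructure k A V where
  coact := tensorOne k A V
  coassoc := by
    ext v
    simp [Algebra.TensorProduct.one_def]
  counital := by
    ext v
    simp

/-- `φ : V → W` is a homomorphism of `G`-modules (a `G`-equivariant `k`-linear map):
`Δ_W ∘ φ = (φ ⊗ id) ∘ Δ_V`. -/
def IsHom (ρ : GModuleStructure k A V) (σ : GModuleStructure k A W) (φ : V →ₗ[k] W) : Prop :=
  σ.coact ∘ₗ φ = φ.rTensor A ∘ₗ ρ.coact

/-- The differential `∂₀ = Δ_V - (id ⊗ 1)` of the Hochschild complex. -/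
noncomputable def d0 (ρ : GModuleStructure k A V) : V →ₗ[k] V ⊗[k] A :=
  ρ.coact - tensorOne k A V

/-- The differential `∂₁ (v ⊗ f) = Δ_V(v) ⊗ f - v ⊗ Δ(f) + v ⊗ f ⊗ 1` of the Hochschild
complex. -/
noncomputable def d1 (ρ : GModuleStructure k A V) : V ⊗[k] A →ₗ[k] V ⊗[k] (A ⊗[k] A) :=
  (TensorProduct.assoc k V A A).toLinearMap ∘ₗ ρ.coact.rTensor A
    - (Coalgebra.comul (R := k) (A := A)).lTensor V
    + (tensorOne k A A).lTensor V

theorem d1_comp_d0 (ρ : GModuleStructure k A V) : ρ.d1 ∘ₗ ρ.d0 = 0 := by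
  have h := ρ.coassoc
  have h1 : (tensorOne k A A).lTensor V ∘ₗ ρ.coact =
      (TensorProduct.assoc k V A A).toLinearMap ∘ₗ ρ.coact.rTensor A ∘ₗ tensorOne k A V := by
    ext v
    simp only [LinearMap.comp_apply, tensorOne_apply, LinearMap.rTensor_tmul,
      LinearEquiv.coe_coe]
    induction ρ.coact v using TensorProduct.induction_on with
    | zero => simp
    | tmul x a => simp
    | add x y hx hy => rw [map_add, hx, hy, TensorProduct.add_tmul, map_add]
  ext v
  have hv := LinearMap.congr_fun h v
  have h1v := LinearMap.congr_fun h1 v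
  simp only [LinearMap.comp_apply, LinearEquiv.coe_coe] at hv h1v
  simp only [d1, d0, LinearMap.comp_apply, LinearMap.sub_apply, LinearMap.add_apply, map_sub,
    LinearEquiv.coe_coe, hv, h1v, LinearMap.zero_apply]
  simp [Algebra.TensorProduct.one_def]

/-- The invariants `V^G = {v ∈ V | Δ_V(v) = v ⊗ 1}`. -/
noncomputable def invariants (ρ : GModuleStructure k A V) : Submodule k V :=
  LinearMap.eqLocus ρ.coact (tensorOne k A V)

/-- The 1-cocycles `Z¹(G, V) = ker ∂₁`. -/
noncomputable def Z1 (ρ : GModuleStructure k A V) : Submodule k (V ⊗[k] A) :=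
  LinearMap.ker ρ.d1

/-- The 1-coboundaries `B¹(G, V) = im ∂₀`. -/
noncomputable def B1 (ρ : GModuleStructure k A V) : Submodule k (V ⊗[k] A) :=
  LinearMap.range ρ.d0

/-- The first Hochschild cohomology group `H¹(G, V) = Z¹(G, V) / B¹(G, V)`. -/
abbrev H1 (ρ : GModuleStructure k A V) : Type u :=
  ρ.Z1 ⧸ ρ.B1.submoduleOf ρ.Z1

/-- `R : V → V^G` is a Reynolds operator: it is `G`-equivariant (for the trivial action on `V^G`),
has image `V^G`, and restricts to the identity on `V^G`. -/
def IsReynoldsOperator (ρ : GModuleStructure k A V) (R : V →ₗ[k] ρ.invariants) : Prop :=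
  IsHom ρ (trivial k A ρ.invariants) R ∧ LinearMap.range R = ⊤ ∧
    ∀ v : ρ.invariants, R (v : V) = v

end

end GModuleStructure

/-- A functorial Reynolds operator for `G`: a choice of a Reynolds operator for every `G`-module,
compatible with all homomorphisms of `G`-modules. -/
structure FunctorialReynoldsOperator (k A : Type u) [CommRing k] [CommRing A]
    [HopfAlgebra k A] where
  op : ∀ (V : Type u) [AddCommGroup V] [Module k V] (ρ : GModuleStructure k A V),
    V →ₗ[k] ρ.invariants
  isReynolds : ∀ (V : Type u) [AddCommGroup V] [Module k V] (ρ : GModuleStructure k A V),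
    ρ.IsReynoldsOperator (op V ρ)
  natural : ∀ (V W : Type u) [AddCommGroup V] [Module k V] [AddCommGroup W] [Module k W]
    (ρ : GModuleStructure k A V) (σ : GModuleStructure k A W) (φ : V →ₗ[k] W),
    GModuleStructure.IsHom ρ σ φ → ∀ v : V, (op W σ (φ v) : W) = φ (op V ρ v : V)

/-- `G` is linearly reductive: `H¹(G, V) = 0` for every `G`-module `V`. -/
def IsLinearlyReductive (k A : Type u) [CommRing k] [CommRing A] [HopfAlgebra k A] : Prop :=
  ∀ (V : Type u) [AddCommGroup V] [Module k V] (ρ : GModuleStructure k A V), Subsingleton ρ.H1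

/-- A `k`-submodule `P ⊆ k[G]` stable under translation of functions by `G` on both sides:
`Δ(P) ⊆ P ⊗ k[G]` (the action `(g f)(x) = f(x g)`) and `Δ(P) ⊆ k[G] ⊗ P`
(the action `(g f)(x) = f(g⁻¹ x)`). -/
def IsTranslationStable (k A : Type u) [CommRing k] [CommRing A] [HopfAlgebra k A]
    (P : Submodule k A) : Prop :=
  ∀ p ∈ P, Coalgebra.comul (R := k) p ∈ LinearMap.range (P.subtype.rTensor A) ∧
    Coalgebra.comul (R := k) p ∈ LinearMap.range (P.subtype.lTensor A)

/-!
For (a), a 1-cocycle `c` with values in `V` defines an extension `V × k` of the trivial module `k`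
by `V`. A functorial Reynolds operator, being compatible with the projection to `k`, moves `(0, 1)`
to an invariant vector `(v, 1)`, and its invariance says that `c` is the coboundary of `-v`
(`FunctorialReynoldsOperator.isLinearlyReductive`).

For (b), everything follows from an invariant integral: an equivariant functional `I : k[G] → k`
with `I 1 = 1`. Comparing it with `I ∘ S`, where `S` is the antipode, shows that it is invariant
on both sides (`GModuleStructure.rid_lTensor_comul_of_isHom`). Then `v ↦ ∑ I(v₁) v₀` is a
functorial Reynolds operator, and `ker I` is the required complement of the constants.

To construct `I`, note that `k[G]` is flat over `k`, because it is smooth, so that the vanishing of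
`H¹` makes the functor of invariants preserve surjections
(`GModuleStructure.IsHom.exists_mem_invariants_eq`), and that over a noetherian base `k[G]` is the
directed union of its finitely generated `G`-submodules `U` containing `1`
(`GModuleStructure.exists_fg_isStable`). Over a Dedekind domain such a `U` is projective, so its
dual is again a `G`-module, on which evaluation at `1` is an equivariant surjection to `k` (the
counit takes the value `1` at `1`). Lifting `1 ∈ k` to an invariant of the dual gives an
equivariant functional on `U` with value `1` at `1`. It is unique: the difference `ψ` of two such
functionals maps `U` onto a trivial `G`-module, to which `U^G` surjects, but `U^G` consists of
constants and `ψ` kills these. So the functionals on the various `U` glue to `I`.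
-/

/-! ### The antipode of a commutative Hopf algebra -/

namespace HopfAlgebra

section

variable {k A : Type*} [CommRing k] [CommRing A] [HopfAlgebra k A]

theorem antipode_antipode (a : A) : antipode k (antipode k a) = a := by
  have h : ((WithConv.toConv (AlgHom.id k A))⁻¹)⁻¹ = WithConv.toConv (AlgHom.id k A) := inv_inv _
  exact DFunLike.congr_fun (congrArg WithConv.ofConv h) a

/-- The antipode reverses the comultiplication. In the convolution group of algebra homomorphisms
`A → A ⊗ A` the comultiplication is the product of the two inclusions, and precomposing with the
antipode is inversion. -/
theorem comul_antipode (a : A) : Coalgebra.comul (R := k) (antipode k a) =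
    TensorProduct.map (antipode k) (antipode k)
      (TensorProduct.comm k A A (Coalgebra.comul (R := k) a)) := by
  let i₁ : WithConv (A →ₐ[k] A ⊗[k] A) := WithConv.toConv Algebra.TensorProduct.includeLeft
  let i₂ : WithConv (A →ₐ[k] A ⊗[k] A) := WithConv.toConv Algebra.TensorProduct.includeRight
  have h : i₁ * i₂ = WithConv.toConv (Bialgebra.comulAlgHom k A) := by
    apply WithConv.ofConv_injective
    ext a
    change (i₁ * i₂) a = _
    rw [AlgHom.convMul_apply]
    simp only [Bialgebra.comulAlgHom_apply]
    induction Coalgebra.comul (R := k) a using TensorProduct.induction_on with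
    | zero => simp
    | tmul x y => simp [i₁, i₂]
    | add x y hx hy => rw [map_add, hx, hy]
  have h' : (WithConv.toConv (Bialgebra.comulAlgHom k A))⁻¹ = i₂⁻¹ * i₁⁻¹ := by
    rw [← h]
    exact mul_inv_rev i₁ i₂
  have ha : Coalgebra.comul (R := k) (antipode k a) = (i₂⁻¹ * i₁⁻¹) a :=
    DFunLike.congr_fun (congrArg WithConv.ofConv h') a
  rw [ha, AlgHom.convMul_apply]
  induction Coalgebra.comul (R := k) a using TensorProduct.induction_on with
  | zero => simp
  | tmul x y =>
    change ((1 : A) ⊗ₜ[k] antipode k x) * (antipode k y ⊗ₜ[k] (1 : A)) = _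
    simp
  | add x y hx hy => simp only [map_add, hx, hy]

end

end HopfAlgebra

/-! ### The Hochschild complex in degrees 0 and 1 -/

namespace GModuleStructure

section

variable {k A V W : Type u} [CommRing k] [CommRing A] [HopfAlgebra k A]
  [AddCommGroup V] [Module k V] [AddCommGroup W] [Module k W]

theorem coassoc_apply (ρ : GModuleStructure k A V) (v : V) :
    TensorProduct.assoc k V A A (ρ.coact.rTensor A (ρ.coact v)) =
      (Coalgebra.comul (R := k) (A := A)).lTensor V (ρ.coact v) :=
  LinearMap.congr_fun ρ.coassoc v

theorem counital_apply (ρ : GModuleStructure k A V) (v : V) :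
    TensorProduct.rid k V ((Coalgebra.counit (R := k) (A := A)).lTensor V (ρ.coact v)) = v :=
  LinearMap.congr_fun ρ.counital v

theorem isHom_iff {ρ : GModuleStructure k A V} {σ : GModuleStructure k A W} {φ : V →ₗ[k] W} :
    IsHom ρ σ φ ↔ ∀ v, σ.coact (φ v) = φ.rTensor A (ρ.coact v) :=
  LinearMap.ext_iff

theorem mem_invariants {ρ : GModuleStructure k A V} {v : V} :
    v ∈ ρ.invariants ↔ ρ.coact v = v ⊗ₜ[k] (1 : A) :=
  LinearMap.mem_eqLocus

theorem d0_apply (ρ : GModuleStructure k A V) (v : V) :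
    ρ.d0 v = ρ.coact v - v ⊗ₜ[k] (1 : A) := rfl

theorem subsingleton_H1_iff (ρ : GModuleStructure k A V) :
    Subsingleton ρ.H1 ↔ ∀ c, ρ.d1 c = 0 → ∃ v, ρ.d0 v = c := by
  rw [Submodule.Quotient.subsingleton_iff, Submodule.submoduleOf_eq_top]
  rfl

theorem IsHom.d0_map {ρ : GModuleStructure k A V} {σ : GModuleStructure k A W} {φ : V →ₗ[k] W}
    (h : IsHom ρ σ φ) (v : V) : σ.d0 (φ v) = φ.rTensor A (ρ.d0 v) := by
  simp [d0_apply, isHom_iff.1 h v]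

theorem IsHom.d1_map {ρ : GModuleStructure k A V} {σ : GModuleStructure k A W} {φ : V →ₗ[k] W}
    (h : IsHom ρ σ φ) (c : V ⊗[k] A) :
    σ.d1 (φ.rTensor A c) = φ.rTensor (A ⊗[k] A) (ρ.d1 c) := by
  have hassoc : ∀ (x : V ⊗[k] A) (a : A), TensorProduct.assoc k W A A (φ.rTensor A x ⊗ₜ[k] a) =
      φ.rTensor (A ⊗[k] A) (TensorProduct.assoc k V A A (x ⊗ₜ[k] a)) := by
    intro x a
    induction x using TensorProduct.induction_on with
    | zero => simp
    | tmul x b => simp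
    | add x y hx hy => simp only [map_add, TensorProduct.add_tmul, hx, hy]
  induction c using TensorProduct.induction_on with
  | zero => simp
  | tmul v a =>
    simp [d1, isHom_iff.1 h v, hassoc]
  | add x y hx hy => simp only [map_add, hx, hy]

/-! ### Extensions by cocycles -/

/-- A cocycle vanishes under the counit: contract both copies of `k[G]` in the cocycle condition
with the counit. -/
theorem rid_counit_of_d1_eq_zero (ρ : GModuleStructure k A V) {c : V ⊗[k] A} (hc : ρ.d1 c = 0) :
    TensorProduct.rid k V ((Coalgebra.counit (R := k) (A := A)).lTensor V c) = 0 := by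
  let ε := Coalgebra.counit (R := k) (A := A)
  let F : V ⊗[k] (A ⊗[k] A) →ₗ[k] V := (TensorProduct.rid k V).toLinearMap ∘ₗ
    (LinearMap.mul' k k ∘ₗ TensorProduct.map ε ε).lTensor V
  have hassoc : ∀ (x : V ⊗[k] A) (a : A), F (TensorProduct.assoc k V A A (x ⊗ₜ[k] a)) =
      ε a • TensorProduct.rid k V (ε.lTensor V x) := by
    intro x a
    induction x using TensorProduct.induction_on with
    | zero => simp
    | tmul x b => simp [F, smul_smul, mul_comm]
    | add x y hx hy => simp only [map_add, TensorProduct.add_tmul, hx, hy, smul_add]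
  have hε : LinearMap.mul' k k ∘ₗ TensorProduct.map ε ε ∘ₗ Coalgebra.comul (R := k) (A := A) =
      ε := by
    ext a
    have h := congrArg (fun x => ε (TensorProduct.lid k A x))
      (Coalgebra.rTensor_counit_comul (R := k) a)
    simp only [LinearMap.comp_apply, TensorProduct.lid_tmul, one_smul] at h ⊢
    rw [← h]
    induction Coalgebra.comul (R := k) a using TensorProduct.induction_on with
    | zero => simp
    | tmul x y => simp [ε]
    | add x y hx hy => simp only [map_add, hx, hy]
  have hF : ∀ c, F (ρ.d1 c) = TensorProduct.rid k V (ε.lTensor V c) := by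
    intro c
    induction c using TensorProduct.induction_on with
    | zero => simp
    | tmul v a =>
      have h1 := hassoc (ρ.coact v) a
      rw [ρ.counital_apply] at h1
      have h2 := LinearMap.congr_fun hε a
      simp only [LinearMap.comp_apply] at h2
      simp only [d1, LinearMap.add_apply, LinearMap.sub_apply, LinearMap.comp_apply,
        LinearMap.rTensor_tmul, LinearEquiv.coe_coe, map_add, map_sub, h1,
        LinearMap.lTensor_tmul]
      simp [F, h2, ε]
    | add x y hx hy => simp only [map_add, hx, hy]
  rw [← hF, hc, map_zero]

/-- The extension `0 → V → V × k → k → 0` of the trivial `G`-module `k` by `V` defined by a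
1-cocycle `c`: the coaction sends `(0, 1)` to `(0, 1) ⊗ 1 + c`. -/
noncomputable def cocycleExtension (ρ : GModuleStructure k A V) (c : V ⊗[k] A)
    (hc : ρ.d1 c = 0) : GModuleStructure k A (V × k) where
  coact := LinearMap.coprod ((LinearMap.inl k V k).rTensor A ∘ₗ ρ.coact)
    (LinearMap.toSpanSingleton k _
      ((LinearMap.inl k V k).rTensor A c + ((0, 1) : V × k) ⊗ₜ[k] (1 : A)))
  coassoc := by
    set C := LinearMap.coprod ((LinearMap.inl k V k).rTensor A ∘ₗ ρ.coact)
      (LinearMap.toSpanSingleton k _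
        ((LinearMap.inl k V k).rTensor A c + ((0, 1) : V × k) ⊗ₜ[k] (1 : A))) with hC
    have hl : ∀ x : V ⊗[k] A, TensorProduct.assoc k (V × k) A A
        (C.rTensor A ((LinearMap.inl k V k).rTensor A x)) = (LinearMap.inl k V k).rTensor (A ⊗[k] A)
          (TensorProduct.assoc k V A A (ρ.coact.rTensor A x)) := by
      intro x
      induction x using TensorProduct.induction_on with
      | zero => simp
      | tmul v a =>
        have h1 : C (v, 0) = (LinearMap.inl k V k).rTensor A (ρ.coact v) := by simp [C]
        simp only [LinearMap.rTensor_tmul, LinearMap.inl_apply, h1]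
        induction ρ.coact v using TensorProduct.induction_on with
        | zero => simp
        | tmul x b => simp
        | add x y hx hy => simp only [map_add, TensorProduct.add_tmul, hx, hy]
      | add x y hx hy => simp only [map_add, hx, hy]
    have hr : ∀ x : V ⊗[k] A, (Coalgebra.comul (R := k) (A := A)).lTensor (V × k)
        ((LinearMap.inl k V k).rTensor A x) = (LinearMap.inl k V k).rTensor (A ⊗[k] A)
          ((Coalgebra.comul (R := k) (A := A)).lTensor V x) := fun x => by
      rw [← LinearMap.comp_apply, ← LinearMap.comp_apply, LinearMap.lTensor_comp_rTensor,
        LinearMap.rTensor_comp_lTensor]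
    have hone : ∀ x : V ⊗[k] A, TensorProduct.assoc k (V × k) A A
        ((LinearMap.inl k V k).rTensor A x ⊗ₜ[k] (1 : A)) =
        (LinearMap.inl k V k).rTensor (A ⊗[k] A) ((tensorOne k A A).lTensor V x) := by
      intro x
      induction x using TensorProduct.induction_on with
      | zero => simp
      | tmul v a => simp
      | add x y hx hy => simp only [map_add, TensorProduct.add_tmul, hx, hy]
    apply LinearMap.prod_ext
    · ext v
      have h1 : C (v, 0) = (LinearMap.inl k V k).rTensor A (ρ.coact v) := by simp [C]
      simp only [LinearMap.comp_apply, LinearEquiv.coe_coe, LinearMap.inl_apply, h1, hl, hr,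
        ρ.coassoc_apply]
    · ext
      have h1 : C (0, 1) = (LinearMap.inl k V k).rTensor A c +
        ((0, 1) : V × k) ⊗ₜ[k] (1 : A) := by simp [C]
      have hc' : TensorProduct.assoc k V A A (ρ.coact.rTensor A c) + (tensorOne k A A).lTensor V c =
          (Coalgebra.comul (R := k) (A := A)).lTensor V c := by
        rw [← sub_eq_zero, ← hc]
        simp only [d1, LinearMap.add_apply, LinearMap.sub_apply, LinearMap.comp_apply,
          LinearEquiv.coe_coe]
        abel
      simp only [LinearMap.comp_apply, LinearEquiv.coe_coe, LinearMap.inr_apply, h1, map_add,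
        LinearMap.rTensor_tmul, TensorProduct.add_tmul, hl, hr, hone, ← hc',
        LinearMap.lTensor_tmul, TensorProduct.assoc_tmul, Bialgebra.comul_one,
        Algebra.TensorProduct.one_def]
      abel
  counital := by
    have hr : ∀ x : V ⊗[k] A, TensorProduct.rid k (V × k)
        ((Coalgebra.counit (R := k) (A := A)).lTensor (V × k)
        ((LinearMap.inl k V k).rTensor A x)) = LinearMap.inl k V k
          (TensorProduct.rid k V ((Coalgebra.counit (R := k) (A := A)).lTensor V x)) := by
      intro x
      induction x using TensorProduct.induction_on with
      | zero => simp only [map_zero]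
      | tmul v a => simp
      | add x y hx hy => simp only [map_add, hx, hy]
    apply LinearMap.prod_ext
    · ext v : 1
      simp [hr, ρ.counital_apply]
    · ext : 1
      simp [hr, ρ.rid_counit_of_d1_eq_zero hc]

theorem cocycleExtension_coact_apply (ρ : GModuleStructure k A V) (c : V ⊗[k] A)
    (hc : ρ.d1 c = 0) (v : V) (t : k) : (ρ.cocycleExtension c hc).coact (v, t) =
      (LinearMap.inl k V k).rTensor A (ρ.coact v) +
        t • ((LinearMap.inl k V k).rTensor A c + ((0, 1) : V × k) ⊗ₜ[k] (1 : A)) := by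
  simp [cocycleExtension]

theorem isHom_snd_cocycleExtension (ρ : GModuleStructure k A V) (c : V ⊗[k] A)
    (hc : ρ.d1 c = 0) :
    IsHom (ρ.cocycleExtension c hc) (trivial k A k) (LinearMap.snd k V k) := by
  have h0 : ∀ x : V ⊗[k] A,
      (LinearMap.snd k V k).rTensor A ((LinearMap.inl k V k).rTensor A x) = 0 := fun x => by
    rw [← LinearMap.rTensor_comp_apply, LinearMap.snd_comp_inl, LinearMap.rTensor_zero,
      LinearMap.zero_apply]
  rw [isHom_iff]
  rintro ⟨v, t⟩
  rw [cocycleExtension_coact_apply]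
  simp [h0, trivial, TensorProduct.smul_tmul']

end

end GModuleStructure

open GModuleStructure

/-- A Reynolds operator on the extension `V × k` defined by a cocycle `c` moves `(0, 1)` to an
invariant vector `(v, 1)`, and invariance of this vector says `c = ∂₀ (-v)`. -/
theorem FunctorialReynoldsOperator.isLinearlyReductive {k A : Type u} [CommRing k] [CommRing A]
    [HopfAlgebra k A] (R : FunctorialReynoldsOperator k A) : IsLinearlyReductive k A := by
  intro V _ _ ρ
  rw [subsingleton_H1_iff]
  intro c hc
  let E := ρ.cocycleExtension c hc
  have hs := R.natural (V × k) k E (trivial k A k) (LinearMap.snd k V k)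
    (ρ.isHom_snd_cocycleExtension c hc) (0, 1)
  have h1 := (R.isReynolds k (trivial k A k)).2.2 ⟨1, mem_invariants.2 rfl⟩
  rw [LinearMap.snd_apply, LinearMap.snd_apply, h1] at hs
  generalize R.op (V × k) E (0, 1) = x at hs
  obtain ⟨⟨v, s⟩, hx⟩ := x
  obtain rfl : 1 = s := hs
  have h0 : ∀ x : V ⊗[k] A,
      (LinearMap.fst k V k).rTensor A ((LinearMap.inl k V k).rTensor A x) = x := fun x => by
    rw [← LinearMap.rTensor_comp_apply, LinearMap.fst_comp_inl, LinearMap.rTensor_id,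
      LinearMap.id_apply]
  have h := congrArg ((LinearMap.fst k V k).rTensor A) (mem_invariants.1 hx)
  rw [cocycleExtension_coact_apply] at h
  simp only [map_add, h0, one_smul, LinearMap.rTensor_tmul, LinearMap.fst_apply,
    TensorProduct.zero_tmul, add_zero] at h
  exact ⟨-v, by rw [map_neg, GModuleStructure.d0_apply, ← h]; abel⟩

namespace GModuleStructure

section

variable {k A V W : Type u} [CommRing k] [CommRing A] [HopfAlgebra k A]
  [AddCommGroup V] [Module k V] [AddCommGroup W] [Module k W]

/-! ### Submodules and exactness of invariants for flat groups -/

/-- `K` is a `G`-submodule of `V`: the coaction maps `K` into the image of `K ⊗ k[G]`. -/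
def IsStable (ρ : GModuleStructure k A V) (K : Submodule k V) : Prop :=
  ∀ x ∈ K, ρ.coact x ∈ LinearMap.range (K.subtype.rTensor A)

theorem rTensor_subtype_injective (B : Type u) [AddCommGroup B] [Module k B] [Module.Flat k B]
    (K : Submodule k V) : Function.Injective (K.subtype.rTensor B) :=
  Module.Flat.rTensor_preserves_injective_linearMap _ K.injective_subtype

theorem mem_range_rTensor_ker_subtype [Module.Flat k A] (f : V →ₗ[k] W) (x : V ⊗[k] A) :
    x ∈ LinearMap.range ((LinearMap.ker f).subtype.rTensor A) ↔ f.rTensor A x = 0 :=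
  (Module.Flat.rTensor_exact A (LinearMap.exact_subtype_ker_map f) x).symm

theorem ker_rTensor_comp_coact_le (ρ : GModuleStructure k A V) (f : V →ₗ[k] W) :
    LinearMap.ker (f.rTensor A ∘ₗ ρ.coact) ≤ LinearMap.ker f := by
  intro x hx
  have h : ∀ y : V ⊗[k] A, f (TensorProduct.rid k V
      ((Coalgebra.counit (R := k) (A := A)).lTensor V y)) = TensorProduct.rid k W
      ((Coalgebra.counit (R := k) (A := A)).lTensor W (f.rTensor A y)) := by
    intro y
    induction y using TensorProduct.induction_on with
    | zero => simp
    | tmul v a => simp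
    | add x y hx hy => simp only [map_add, hx, hy]
  rw [LinearMap.mem_ker, ← ρ.counital_apply x, h, show f.rTensor A (ρ.coact x) = 0 from hx,
    map_zero, map_zero]

variable [Module.Flat k A]

/-- The coaction induced on a `G`-submodule. -/
noncomputable def restrictCoact (ρ : GModuleStructure k A V) (K : Submodule k V)
    (hK : ρ.IsStable K) : K →ₗ[k] K ⊗[k] A :=
  (LinearEquiv.ofInjective (K.subtype.rTensor A) (rTensor_subtype_injective A K)).symm.toLinearMap
    ∘ₗ (ρ.coact ∘ₗ K.subtype).codRestrict _ (fun x => hK x x.2)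

theorem rTensor_subtype_restrictCoact (ρ : GModuleStructure k A V) (K : Submodule k V)
    (hK : ρ.IsStable K) (x : K) :
    K.subtype.rTensor A (ρ.restrictCoact K hK x) = ρ.coact x :=
  congrArg Subtype.val (LinearEquiv.apply_symm_apply
    (LinearEquiv.ofInjective (K.subtype.rTensor A) (rTensor_subtype_injective A K)) _)

/-- The `G`-module structure induced on a `G`-submodule, for flat `G`. -/
noncomputable def restrict (ρ : GModuleStructure k A V) (K : Submodule k V)
    (hK : ρ.IsStable K) : GModuleStructure k A K where
  coact := ρ.restrictCoact K hK
  coassoc := by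
    ext x
    apply rTensor_subtype_injective (A ⊗[k] A) K
    have hl : ∀ y : K ⊗[k] A, K.subtype.rTensor (A ⊗[k] A)
        (TensorProduct.assoc k K A A ((ρ.restrictCoact K hK).rTensor A y)) =
        TensorProduct.assoc k V A A (ρ.coact.rTensor A (K.subtype.rTensor A y)) := by
      intro y
      induction y using TensorProduct.induction_on with
      | zero => simp
      | tmul v a =>
        simp only [LinearMap.rTensor_tmul, Submodule.subtype_apply,
          ← rTensor_subtype_restrictCoact ρ K hK]
        induction ρ.restrictCoact K hK v using TensorProduct.induction_on with
        | zero => simp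
        | tmul x b => simp
        | add x y hx hy => simp only [map_add, TensorProduct.add_tmul, hx, hy]
      | add x y hx hy => simp only [map_add, hx, hy]
    simp only [LinearMap.comp_apply, LinearEquiv.coe_coe, hl]
    rw [← LinearMap.comp_apply (K.subtype.rTensor _) (LinearMap.lTensor _ _),
      LinearMap.rTensor_comp_lTensor, ← LinearMap.lTensor_comp_rTensor, LinearMap.comp_apply,
      rTensor_subtype_restrictCoact, ρ.coassoc_apply]
  counital := by
    ext x
    have hr : ∀ y : K ⊗[k] A, (TensorProduct.rid k K
        ((Coalgebra.counit (R := k) (A := A)).lTensor K y) : V) =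
        TensorProduct.rid k V ((Coalgebra.counit (R := k) (A := A)).lTensor V
          (K.subtype.rTensor A y)) := by
      intro y
      induction y using TensorProduct.induction_on with
      | zero => simp
      | tmul v a => simp
      | add x y hx hy => simp only [map_add, Submodule.coe_add, hx, hy]
    simp only [LinearMap.comp_apply, LinearEquiv.coe_coe, hr, rTensor_subtype_restrictCoact,
      ρ.counital_apply, LinearMap.id_apply]

theorem rTensor_subtype_restrict_coact (ρ : GModuleStructure k A V) (K : Submodule k V)
    (hK : ρ.IsStable K) (x : K) :
    K.subtype.rTensor A ((ρ.restrict K hK).coact x) = ρ.coact x :=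
  ρ.rTensor_subtype_restrictCoact K hK x

theorem isHom_subtype (ρ : GModuleStructure k A V) (K : Submodule k V)
    (hK : ρ.IsStable K) : IsHom (ρ.restrict K hK) ρ K.subtype :=
  isHom_iff.2 fun x => (ρ.rTensor_subtype_restrict_coact K hK x).symm

theorem IsHom.isStable_ker {ρ : GModuleStructure k A V} {σ : GModuleStructure k A W}
    {φ : V →ₗ[k] W} (h : IsHom ρ σ φ) : ρ.IsStable (LinearMap.ker φ) := by
  intro x hx
  rw [mem_range_rTensor_ker_subtype, ← isHom_iff.1 h, LinearMap.mem_ker.1 hx, map_zero]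

/-- If `G` is flat and linearly reductive, then taking invariants preserves surjectivity: the
obstruction to lifting an invariant vector lies in `H¹` of the kernel. -/
theorem IsHom.exists_mem_invariants_eq (hred : IsLinearlyReductive k A)
    {ρ : GModuleStructure k A V} {σ : GModuleStructure k A W} {φ : V →ₗ[k] W} (h : IsHom ρ σ φ)
    (hφ : Function.Surjective φ) {w : W} (hw : w ∈ σ.invariants) :
    ∃ v ∈ ρ.invariants, φ v = w := by
  obtain ⟨v, rfl⟩ := hφ w
  have hsub := ρ.isHom_subtype _ h.isStable_ker
  have hv : ρ.d0 v ∈ LinearMap.range ((LinearMap.ker φ).subtype.rTensor A) := by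
    rw [mem_range_rTensor_ker_subtype, ← h.d0_map, d0_apply, mem_invariants.1 hw, sub_self]
  obtain ⟨c, hc⟩ := hv
  have hc0 : (ρ.restrict _ h.isStable_ker).d1 c = 0 := by
    apply rTensor_subtype_injective (A ⊗[k] A)
    rw [← hsub.d1_map, hc, map_zero, ← LinearMap.comp_apply, d1_comp_d0, LinearMap.zero_apply]
  obtain ⟨y, rfl⟩ := (subsingleton_H1_iff _).1 (hred _ (ρ.restrict _ h.isStable_ker)) c hc0
  refine ⟨v - y, ?_, by simp⟩
  rw [mem_invariants, ← sub_eq_zero, ← d0_apply, map_sub, ← hc, ← hsub.d0_map,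
    Submodule.subtype_apply, sub_self]

/-! ### Local finiteness -/

/-- The kernel of `(f ⊗ id) ∘ Δ_V`, which is the largest `G`-submodule contained in `ker f`, is
stable: by coassociativity `(f ⊗ id ⊗ id) (Δ_V ⊗ id) Δ_V = (id ⊗ Δ) (f ⊗ id) Δ_V`, and by flatness
of `k[G]` tensoring with `k[G]` commutes with kernels. -/
theorem isStable_ker_rTensor_comp_coact (ρ : GModuleStructure k A V) (f : V →ₗ[k] W) :
    ρ.IsStable (LinearMap.ker (f.rTensor A ∘ₗ ρ.coact)) := by
  intro x hx
  rw [mem_range_rTensor_ker_subtype]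
  apply (TensorProduct.assoc k W A A).injective
  have h : ∀ y : V ⊗[k] A, TensorProduct.assoc k W A A ((f.rTensor A ∘ₗ ρ.coact).rTensor A y) =
      f.rTensor (A ⊗[k] A) (TensorProduct.assoc k V A A (ρ.coact.rTensor A y)) := by
    intro y
    induction y using TensorProduct.induction_on with
    | zero => simp
    | tmul v a =>
      simp only [LinearMap.rTensor_tmul, LinearMap.comp_apply]
      induction ρ.coact v using TensorProduct.induction_on with
      | zero => simp
      | tmul x b => simp
      | add x y hx hy => simp only [map_add, TensorProduct.add_tmul, hx, hy]
    | add x y hx hy => simp only [map_add, hx, hy]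
  rw [h, ρ.coassoc_apply, ← LinearMap.comp_apply, LinearMap.rTensor_comp_lTensor,
    ← LinearMap.lTensor_comp_rTensor, LinearMap.comp_apply,
    show f.rTensor A (ρ.coact x) = 0 from hx, map_zero, map_zero]

/-- Over a noetherian base, every finitely generated submodule of a `G`-module is contained in a
finitely generated `G`-submodule (for flat `G`): if `Δ_V(N) ⊆ E ⊗ k[G]` with `E` finitely generated,
the largest `G`-submodule contained in `E` contains `N`. -/
theorem exists_fg_isStable [IsNoetherianRing k] (ρ : GModuleStructure k A V)
    {N : Submodule k V} (hN : N.FG) : ∃ M : Submodule k V, N ≤ M ∧ M.FG ∧ ρ.IsStable M := by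
  classical
  obtain ⟨s, rfl⟩ := hN
  obtain ⟨E, hE, hsE⟩ := TensorProduct.exists_finite_submodule_left_of_setFinite
    (ρ.coact '' (s : Set V)) (s.finite_toSet.image _)
  refine ⟨LinearMap.ker (E.mkQ.rTensor A ∘ₗ ρ.coact), ?_, ?_,
    ρ.isStable_ker_rTensor_comp_coact E.mkQ⟩
  · rw [Submodule.span_le]
    intro x hx
    obtain ⟨y, hy⟩ := hsE ⟨x, hx, rfl⟩
    rw [SetLike.mem_coe, LinearMap.mem_ker, LinearMap.comp_apply, ← hy,
      ← LinearMap.rTensor_comp_apply]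
    have : E.mkQ ∘ₗ E.subtype = 0 := by ext; simp
    simp [this]
  · have hle := ρ.ker_rTensor_comp_coact_le E.mkQ
    rw [Submodule.ker_mkQ] at hle
    exact Submodule.FG.of_le (Module.Finite.iff_fg.1 hE) hle

end

end GModuleStructure

namespace GModuleStructure

section

variable {k A V W : Type u} [CommRing k] [CommRing A] [HopfAlgebra k A]
  [AddCommGroup V] [Module k V] [AddCommGroup W] [Module k W]

/-! ### The contragredient module -/

/-- The contragredient action in the form `V^* → Hom(V, k[G])`: a functional `φ` goes to
`v ↦ ∑ φ(v₀) S(v₁)`, where `Δ_V(v) = ∑ v₀ ⊗ v₁` and `S` is the antipode. -/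
noncomputable def contragredientHom (ρ : GModuleStructure k A V) :
    Module.Dual k V →ₗ[k] V →ₗ[k] A where
  toFun φ := HopfAlgebra.antipode k ∘ₗ (TensorProduct.lid k A).toLinearMap ∘ₗ φ.rTensor A ∘ₗ
    ρ.coact
  map_add' φ ψ := by
    simp only [LinearMap.rTensor_add, LinearMap.add_comp, LinearMap.comp_add]
  map_smul' t φ := by
    simp only [LinearMap.rTensor_smul, LinearMap.smul_comp, LinearMap.comp_smul, RingHom.id_apply]

theorem contragredientHom_apply (ρ : GModuleStructure k A V) (φ : Module.Dual k V) (v : V) :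
    ρ.contragredientHom φ v =
      HopfAlgebra.antipode k (TensorProduct.lid k A (φ.rTensor A (ρ.coact v))) := rfl

variable [Module.Finite k V] [Module.Projective k V]

/-- The contragredient coaction `V^* → V^* ⊗ k[G]`, transported along
`V^* ⊗ k[G] ≃ Hom(V, k[G])`. -/
noncomputable def contragredientCoact (ρ : GModuleStructure k A V) :
    Module.Dual k V →ₗ[k] Module.Dual k V ⊗[k] A :=
  (LinearEquiv.ofBijective (dualTensorHom k V A) dualTensorHom_bijective).symm.toLinearMap ∘ₗ
    ρ.contragredientHom

theorem dualTensorHom_contragredientCoact (ρ : GModuleStructure k A V) (φ : Module.Dual k V) :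
    dualTensorHom k V A (ρ.contragredientCoact φ) = ρ.contragredientHom φ :=
  LinearEquiv.apply_symm_apply
    (LinearEquiv.ofBijective (dualTensorHom k V A) dualTensorHom_bijective) _

/-- The contragredient `G`-module `V^*` of a finitely generated projective `G`-module `V`. -/
noncomputable def contragredient (ρ : GModuleStructure k A V) :
    GModuleStructure k A (Module.Dual k V) where
  coact := ρ.contragredientCoact
  coassoc := by
    let S := HopfAlgebra.antipode k (A := A)
    ext φ
    apply (dualTensorHom_bijective (R := k) (M := V) (N := A ⊗[k] A)).1
    ext v
    -- Both sides evaluate at `v` to `∑ φ(v₀) S(v₂) ⊗ S(v₁)`.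
    have hl : ∀ x : Module.Dual k V ⊗[k] A, dualTensorHom k V (A ⊗[k] A)
        (TensorProduct.assoc k _ A A (ρ.contragredientCoact.rTensor A x)) v =
        TensorProduct.map S (dualTensorHom k V A x) (TensorProduct.comm k V A (ρ.coact v)) := by
      intro x
      induction x using TensorProduct.induction_on with
      | zero => simp
      | tmul ψ a =>
        have h1 : ∀ y : Module.Dual k V ⊗[k] A, dualTensorHom k V (A ⊗[k] A)
            (TensorProduct.assoc k _ A A (y ⊗ₜ[k] a)) v = dualTensorHom k V A y v ⊗ₜ[k] a := by
          intro y
          induction y using TensorProduct.induction_on with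
          | zero => simp
          | tmul ψ b => simp [TensorProduct.smul_tmul']
          | add x y hx hy => simp only [map_add, TensorProduct.add_tmul, LinearMap.add_apply, hx, hy]
        rw [LinearMap.rTensor_tmul, h1, dualTensorHom_contragredientCoact,
          contragredientHom_apply]
        induction ρ.coact v using TensorProduct.induction_on with
        | zero => simp
        | tmul w b => simp [S, TensorProduct.smul_tmul]
        | add x y hx hy => simp only [map_add, TensorProduct.add_tmul, hx, hy]
      | add x y hx hy =>
        simp only [map_add, LinearMap.add_apply, TensorProduct.map_add_right, hx, hy]
    have hr : ∀ x : Module.Dual k V ⊗[k] A, dualTensorHom k V (A ⊗[k] A)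
        ((Coalgebra.comul (R := k) (A := A)).lTensor _ x) v =
        Coalgebra.comul (R := k) (dualTensorHom k V A x v) := by
      intro x
      induction x using TensorProduct.induction_on with
      | zero => simp
      | tmul ψ a => simp
      | add x y hx hy => simp only [map_add, LinearMap.add_apply, hx, hy]
    simp only [LinearMap.comp_apply, LinearEquiv.coe_coe]
    rw [hl, hr, dualTensorHom_contragredientCoact, contragredientHom_apply,
      HopfAlgebra.comul_antipode]
    have h2 : ∀ y : V ⊗[k] A, Coalgebra.comul (R := k) (TensorProduct.lid k A (φ.rTensor A y)) =
        TensorProduct.lid k _ (φ.rTensor (A ⊗[k] A)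
          ((Coalgebra.comul (R := k) (A := A)).lTensor V y)) := by
      intro y
      induction y using TensorProduct.induction_on with
      | zero => simp
      | tmul w a => simp
      | add x y hx hy => simp only [map_add, hx, hy]
    rw [h2, ← ρ.coassoc_apply]
    induction ρ.coact v using TensorProduct.induction_on with
    | zero => simp
    | tmul w a =>
      simp only [TensorProduct.comm_tmul, TensorProduct.map_tmul, contragredientHom_apply,
        LinearMap.rTensor_tmul]
      induction ρ.coact w using TensorProduct.induction_on with
      | zero => simp
      | tmul u b => simp [S]
      | add x y hx hy => simp only [map_add, TensorProduct.add_tmul, TensorProduct.tmul_add, hx, hy]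
    | add x y hx hy => simp only [map_add, hx, hy]
  counital := by
    ext φ v
    have hl : ∀ x : Module.Dual k V ⊗[k] A, TensorProduct.rid k (Module.Dual k V)
        ((Coalgebra.counit (R := k) (A := A)).lTensor _ x) v =
        Coalgebra.counit (R := k) (dualTensorHom k V A x v) := by
      intro x
      induction x using TensorProduct.induction_on with
      | zero => simp
      | tmul ψ a => simp [mul_comm]
      | add x y hx hy => simp only [map_add, LinearMap.add_apply, hx, hy]
    have h2 : ∀ y : V ⊗[k] A, Coalgebra.counit (R := k) (TensorProduct.lid k A (φ.rTensor A y)) =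
        φ (TensorProduct.rid k V ((Coalgebra.counit (R := k) (A := A)).lTensor V y)) := by
      intro y
      induction y using TensorProduct.induction_on with
      | zero => simp
      | tmul w a => simp [mul_comm]
      | add x y hx hy => simp only [map_add, hx, hy]
    simp only [LinearMap.comp_apply, LinearEquiv.coe_coe, hl, dualTensorHom_contragredientCoact,
      contragredientHom_apply, HopfAlgebra.counit_antipode, h2, ρ.counital_apply,
      LinearMap.id_apply]

theorem dualTensorHom_contragredient_coact (ρ : GModuleStructure k A V) (φ : Module.Dual k V)
    (v : V) : dualTensorHom k V A (ρ.contragredient.coact φ) v =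
      HopfAlgebra.antipode k (TensorProduct.lid k A (φ.rTensor A (ρ.coact v))) :=
  LinearMap.congr_fun (ρ.dualTensorHom_contragredientCoact φ) v

/-- The invariants of the contragredient module are the equivariant functionals. -/
theorem isHom_of_mem_invariants_contragredient (ρ : GModuleStructure k A V)
    {φ : Module.Dual k V} (h : φ ∈ ρ.contragredient.invariants) :
    IsHom ρ (trivial k A k) φ := by
  rw [isHom_iff]
  intro v
  have h1 := ρ.dualTensorHom_contragredient_coact φ v
  rw [mem_invariants.1 h, dualTensorHom_apply] at h1
  have h2 := congrArg (HopfAlgebra.antipode k) h1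
  rw [HopfAlgebra.antipode_antipode, map_smul, HopfAlgebra.antipode_one] at h2
  apply (TensorProduct.lid k A).injective
  rw [← h2]
  simp [trivial]

/-- Evaluation at an invariant vector is equivariant on the contragredient module. -/
theorem isHom_contragredient_eval (ρ : GModuleStructure k A V) {v : V} (hv : v ∈ ρ.invariants) :
    IsHom ρ.contragredient (trivial k A k) (Module.Dual.eval k V v) := by
  rw [isHom_iff]
  intro φ
  have h : ∀ x : Module.Dual k V ⊗[k] A, TensorProduct.lid k A
      ((Module.Dual.eval k V v).rTensor A x) = dualTensorHom k V A x v := by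
    intro x
    induction x using TensorProduct.induction_on with
    | zero => simp
    | tmul ψ a => simp
    | add x y hx hy => simp only [map_add, LinearMap.add_apply, hx, hy]
  apply (TensorProduct.lid k A).injective
  rw [h, dualTensorHom_contragredient_coact, mem_invariants.1 hv]
  simp [trivial]

/-- For linearly reductive flat `G`, an invariant vector on which some functional takes the
value `1` also has an equivariant functional with value `1`. -/
theorem exists_isHom_apply_eq_one [Module.Flat k A] (hred : IsLinearlyReductive k A)
    (ρ : GModuleStructure k A V) {v : V} (hv : v ∈ ρ.invariants) {ε : Module.Dual k V}
    (hε : ε v = 1) : ∃ φ : V →ₗ[k] k, IsHom ρ (trivial k A k) φ ∧ φ v = 1 := by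
  obtain ⟨φ, hφ, h1⟩ := (ρ.isHom_contragredient_eval hv).exists_mem_invariants_eq hred
    (fun t => ⟨t • ε, by simp [hε]⟩) (w := (1 : k)) (mem_invariants.2 rfl)
  exact ⟨φ, ρ.isHom_of_mem_invariants_contragredient hφ, h1⟩

end

end GModuleStructure

namespace GModuleStructure

section

variable (k A : Type u) [CommRing k] [CommRing A] [HopfAlgebra k A]

/-! ### The regular module and the invariant integral -/

/-- The right regular `G`-module `k[G]`, with the comultiplication as coaction. -/
noncomputable def regular : GModuleStructure k A A where
  coact := Coalgebra.comul
  coassoc := Coalgebra.coassoc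
  counital := by
    ext a
    simp

variable {k A}

theorem regular_coact_apply (a : A) : (regular k A).coact a = Coalgebra.comul (R := k) a := rfl

theorem eq_counit_smul_of_comul_eq {a : A} (h : Coalgebra.comul (R := k) a = a ⊗ₜ[k] (1 : A)) :
    a = Coalgebra.counit (R := k) a • (1 : A) := by
  have h1 := Coalgebra.rTensor_counit_comul (R := k) a
  rw [h, LinearMap.rTensor_tmul] at h1
  simpa using (congrArg (TensorProduct.lid k A) h1).symm

variable [Module.Flat k A]

theorem one_mem_invariants_restrict {U : Submodule k A} (hU : (regular k A).IsStable U)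
    (h1 : (1 : A) ∈ U) : (⟨1, h1⟩ : U) ∈ ((regular k A).restrict U hU).invariants := by
  rw [mem_invariants]
  apply rTensor_subtype_injective A U
  rw [rTensor_subtype_restrict_coact, regular_coact_apply]
  simp [Algebra.TensorProduct.one_def]

theorem coe_eq_counit_smul_of_mem_invariants_restrict {U : Submodule k A}
    {hU : (regular k A).IsStable U} {x : U} (hx : x ∈ ((regular k A).restrict U hU).invariants) :
    (x : A) = Coalgebra.counit (R := k) (x : A) • (1 : A) := by
  apply eq_counit_smul_of_comul_eq
  rw [← regular_coact_apply, ← rTensor_subtype_restrict_coact _ U hU, mem_invariants.1 hx]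
  simp

/-- An equivariant functional on a `G`-submodule `U` of `k[G]` is determined by its value at `1`.
The image of the difference of two of them is a trivial `G`-module, to which invariants of `U` lift,
and these are constants. -/
theorem eq_zero_of_isHom_of_apply_one (hred : IsLinearlyReductive k A) {U : Submodule k A}
    (hU : (regular k A).IsStable U) (h1 : (1 : A) ∈ U) {ψ : U →ₗ[k] k}
    (hψ : IsHom ((regular k A).restrict U hU) (trivial k A k) ψ) (hψ1 : ψ ⟨1, h1⟩ = 0) :
    ψ = 0 := by
  have hhom : IsHom ((regular k A).restrict U hU) (trivial k A (LinearMap.range ψ))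
      ψ.rangeRestrict := by
    rw [isHom_iff]
    intro x
    apply rTensor_subtype_injective A (LinearMap.range ψ)
    rw [← LinearMap.rTensor_comp_apply, LinearMap.subtype_comp_codRestrict, ← isHom_iff.1 hψ]
    simp [trivial]
  ext x
  obtain ⟨y, hy, hxy⟩ := hhom.exists_mem_invariants_eq hred ψ.surjective_rangeRestrict
    (w := ψ.rangeRestrict x) (mem_invariants.2 rfl)
  have hy1 : y = Coalgebra.counit (R := k) (y : A) • ⟨1, h1⟩ :=
    Subtype.ext (coe_eq_counit_smul_of_mem_invariants_restrict hy)
  have h0 : ψ y = 0 := by rw [hy1, map_smul, hψ1, smul_zero]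
  exact (congrArg Subtype.val hxy).symm.trans h0

theorem isHom_comp_inclusion {U U' : Submodule k A} (hU : (regular k A).IsStable U)
    (hU' : (regular k A).IsStable U') (hle : U ≤ U') {ψ : U' →ₗ[k] k}
    (hψ : IsHom ((regular k A).restrict U' hU') (trivial k A k) ψ) :
    IsHom ((regular k A).restrict U hU) (trivial k A k) (ψ ∘ₗ Submodule.inclusion hle) := by
  rw [isHom_iff] at hψ ⊢
  intro x
  rw [LinearMap.comp_apply, hψ, LinearMap.rTensor_comp_apply]
  congr 1
  apply rTensor_subtype_injective A U'
  rw [rTensor_subtype_restrict_coact, ← LinearMap.rTensor_comp_apply,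
    Submodule.subtype_comp_inclusion, rTensor_subtype_restrict_coact, Submodule.coe_inclusion]

/-- Over a Dedekind domain, a finitely generated `G`-submodule of `k[G]` containing `1` is
projective, so that it carries a normalised equivariant functional; the counit shows that `1`
is unimodular. -/
theorem exists_isHom_apply_one_eq_one [IsDedekindDomain k] (hred : IsLinearlyReductive k A)
    {U : Submodule k A} (hU : (regular k A).IsStable U) (hfg : U.FG) (h1 : (1 : A) ∈ U) :
    ∃ ψ : U →ₗ[k] k, IsHom ((regular k A).restrict U hU) (trivial k A k) ψ ∧ ψ ⟨1, h1⟩ = 1 := by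
  have : Module.Finite k U := Module.Finite.iff_fg.2 hfg
  have : Module.FinitePresentation k U := Module.finitePresentation_of_finite k U
  have : Module.Projective k U := Module.Flat.projective_of_finitePresentation
  exact ((regular k A).restrict U hU).exists_isHom_apply_eq_one hred
    (one_mem_invariants_restrict hU h1) (ε := Coalgebra.counit (R := k) (A := A) ∘ₗ U.subtype)
    (by simp)

/-- The equivariant normalised functionals on the finitely generated `G`-submodules of `k[G]`
containing `1` agree on overlaps, and glue to a functional on `k[G]`. -/
theorem exists_regular_isHom_apply_one_eq_one [IsDedekindDomain k]
    (hred : IsLinearlyReductive k A) :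
    ∃ I : A →ₗ[k] k, IsHom (regular k A) (trivial k A k) I ∧ I 1 = 1 := by
  have hex : ∀ N : Submodule k A, N.FG → ∃ (U : Submodule k A) (hU : (regular k A).IsStable U)
      (h1 : (1 : A) ∈ U) (ψ : U →ₗ[k] k), N ≤ U ∧
      IsHom ((regular k A).restrict U hU) (trivial k A k) ψ ∧ ψ ⟨1, h1⟩ = 1 ∧ U.FG := by
    intro N hN
    obtain ⟨U, hle, hfg, hU⟩ := (regular k A).exists_fg_isStable
      (hN.sup (Submodule.fg_span_singleton (1 : A)))
    have h1 : (1 : A) ∈ U := hle (Submodule.mem_sup_right (Submodule.mem_span_singleton_self 1))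
    obtain ⟨ψ, hψ, hψ1⟩ := exists_isHom_apply_one_eq_one hred hU hfg h1
    exact ⟨U, hU, h1, ψ, le_sup_left.trans hle, hψ, hψ1, hfg⟩
  have hres : ∀ (U U' : Submodule k A) (hU : (regular k A).IsStable U)
      (hU' : (regular k A).IsStable U') (h1 : (1 : A) ∈ U) (h1' : (1 : A) ∈ U')
      (ψ : U →ₗ[k] k) (ψ' : U' →ₗ[k] k),
      IsHom ((regular k A).restrict U hU) (trivial k A k) ψ →
      IsHom ((regular k A).restrict U' hU') (trivial k A k) ψ' → ψ ⟨1, h1⟩ = 1 →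
      ψ' ⟨1, h1'⟩ = 1 → U ≤ U' → ∀ (a : A) (ha : a ∈ U) (ha' : a ∈ U'), ψ ⟨a, ha⟩ = ψ' ⟨a, ha'⟩ := by
    intro U U' hU hU' h1 h1' ψ ψ' hψ hψ' hψ1 hψ1' hle a ha ha'
    have hsub : IsHom ((regular k A).restrict U hU) (trivial k A k)
        (ψ - ψ' ∘ₗ Submodule.inclusion hle) := by
      have hψ'' := isHom_comp_inclusion hU hU' hle hψ'
      rw [isHom_iff] at hψ hψ'' ⊢
      intro x
      rw [LinearMap.sub_apply, map_sub, hψ, hψ'', LinearMap.rTensor_sub, LinearMap.sub_apply]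
    have h0 := eq_zero_of_isHom_of_apply_one hred hU h1 hsub (by
      rw [LinearMap.sub_apply, hψ1, LinearMap.comp_apply]
      exact sub_eq_zero.2 hψ1'.symm)
    exact sub_eq_zero.1 (LinearMap.congr_fun h0 ⟨a, ha⟩)
  choose! U hU h1 ψ hle hψ hψ1 hfg using fun a : A =>
    hex (Submodule.span k {a}) (Submodule.fg_span_singleton a)
  have hmem : ∀ a, a ∈ U a := fun a => hle a (Submodule.mem_span_singleton_self a)
  have hI : ∀ (V : Submodule k A) (hV : (regular k A).IsStable V) (hV1 : (1 : A) ∈ V)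
      (φ : V →ₗ[k] k), V.FG → IsHom ((regular k A).restrict V hV) (trivial k A k) φ →
      φ ⟨1, hV1⟩ = 1 → ∀ (a : A) (ha : a ∈ V), ψ a ⟨a, hmem a⟩ = φ ⟨a, ha⟩ := by
    intro V hV hV1 φ hVfg hφ hφ1 a ha
    obtain ⟨X, hX, hX1, χ, hleX, hχ, hχ1, -⟩ := hex (U a ⊔ V) ((hfg a).sup hVfg)
    rw [hres (U a) X (hU a) hX (h1 a) hX1 (ψ a) χ (hψ a) hχ (hψ1 a) hχ1
        (le_sup_left.trans hleX) a (hmem a) (hleX (Submodule.mem_sup_right ha)),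
      hres V X hV hX hV1 hX1 φ χ hφ hχ hφ1 hχ1 (le_sup_right.trans hleX) a ha
        (hleX (Submodule.mem_sup_right ha))]
  let I : A →ₗ[k] k :=
    { toFun := fun a => ψ a ⟨a, hmem a⟩
      map_add' := fun a b => by
        obtain ⟨X, hX, hX1, χ, hleX, hχ, hχ1, hXfg⟩ := hex (U a ⊔ U b) ((hfg a).sup (hfg b))
        have ha : a ∈ X := hleX (Submodule.mem_sup_left (hmem a))
        have hb : b ∈ X := hleX (Submodule.mem_sup_right (hmem b))
        rw [hI X hX hX1 χ hXfg hχ hχ1 a ha, hI X hX hX1 χ hXfg hχ hχ1 b hb,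
          hI X hX hX1 χ hXfg hχ hχ1 _ (X.add_mem ha hb), ← map_add]
        rfl
      map_smul' := fun t a => by
        rw [hI (U a) (hU a) (h1 a) (ψ a) (hfg a) (hψ a) (hψ1 a) _ ((U a).smul_mem t (hmem a)),
          RingHom.id_apply, ← map_smul]
        rfl }
  refine ⟨I, isHom_iff.2 fun a => ?_, hψ1 1⟩
  have hIsub : I ∘ₗ (U a).subtype = ψ a := by
    ext x
    exact hI (U a) (hU a) (h1 a) (ψ a) (hfg a) (hψ a) (hψ1 a) x x.2
  have ha := isHom_iff.1 (hψ a) ⟨a, hmem a⟩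
  rw [← hIsub, LinearMap.rTensor_comp_apply, rTensor_subtype_restrict_coact] at ha
  exact ha

end

end GModuleStructure

namespace GModuleStructure

section

variable {k A V W : Type u} [CommRing k] [CommRing A] [HopfAlgebra k A]
  [AddCommGroup V] [Module k V] [AddCommGroup W] [Module k W]

theorem lid_rTensor_comul_of_isHom {I : A →ₗ[k] k} (hI : IsHom (regular k A) (trivial k A k) I)
    (a : A) : TensorProduct.lid k A (I.rTensor A (Coalgebra.comul (R := k) a)) = I a • 1 := by
  rw [← regular_coact_apply, ← isHom_iff.1 hI]
  simp [trivial]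

/-- Precomposing with the antipode turns a functional equivariant on one side into a functional
equivariant on the other side. -/
theorem rid_lTensor_antipode_comul_of_isHom {I : A →ₗ[k] k}
    (hI : IsHom (regular k A) (trivial k A k) I) (a : A) :
    TensorProduct.rid k A
      ((I ∘ₗ HopfAlgebra.antipode k).lTensor A (Coalgebra.comul (R := k) a)) =
      I (HopfAlgebra.antipode k a) • 1 := by
  have h := lid_rTensor_comul_of_isHom hI (HopfAlgebra.antipode k a)
  have hS : ∀ y : A ⊗[k] A, TensorProduct.lid k A (I.rTensor A (TensorProduct.map
      (HopfAlgebra.antipode k) (HopfAlgebra.antipode k) (TensorProduct.comm k A A y))) =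
      HopfAlgebra.antipode k (TensorProduct.rid k A
        ((I ∘ₗ HopfAlgebra.antipode k).lTensor A y)) := by
    intro y
    induction y using TensorProduct.induction_on with
    | zero => simp
    | tmul x y => simp
    | add x y hx hy => simp only [map_add, hx, hy]
  rw [HopfAlgebra.comul_antipode, hS] at h
  rw [← HopfAlgebra.antipode_antipode (k := k) (TensorProduct.rid k A _), h, map_smul,
    HopfAlgebra.antipode_one]

/-- A normalised equivariant functional on `k[G]` is equivariant on the other side as well:
it agrees with its composite with the antipode, as evaluating the two on the two factors of the
comultiplication shows. -/
theorem rid_lTensor_comul_of_isHom {I : A →ₗ[k] k}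
    (hI : IsHom (regular k A) (trivial k A k) I) (hI1 : I 1 = 1) (a : A) :
    TensorProduct.rid k A (I.lTensor A (Coalgebra.comul (R := k) a)) = I a • 1 := by
  let J := I ∘ₗ HopfAlgebra.antipode k
  have h : ∀ y : A ⊗[k] A, J (TensorProduct.lid k A (I.rTensor A y)) =
      I (TensorProduct.rid k A (J.lTensor A y)) := by
    intro y
    induction y using TensorProduct.induction_on with
    | zero => simp
    | tmul x y => simp [mul_comm]
    | add x y hx hy => simp only [map_add, hx, hy]
  have hJ : J = I := by
    ext b
    have hb := h (Coalgebra.comul (R := k) b)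
    rw [lid_rTensor_comul_of_isHom hI, rid_lTensor_antipode_comul_of_isHom hI, map_smul,
      map_smul] at hb
    simpa [J, hI1] using hb.symm
  have h1 := rid_lTensor_antipode_comul_of_isHom hI a
  change TensorProduct.rid k A (J.lTensor A _) = J a • 1 at h1
  rwa [hJ] at h1

/-! ### Reynolds operators from the invariant integral -/

/-- Integration over the group: `v ↦ ∑ I(v₁) v₀`, where `Δ_V(v) = ∑ v₀ ⊗ v₁`. -/
noncomputable def average (ρ : GModuleStructure k A V) (I : A →ₗ[k] k) : V →ₗ[k] V :=
  (TensorProduct.rid k V).toLinearMap ∘ₗ I.lTensor V ∘ₗ ρ.coact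

theorem average_apply (ρ : GModuleStructure k A V) (I : A →ₗ[k] k) (v : V) :
    ρ.average I v = TensorProduct.rid k V (I.lTensor V (ρ.coact v)) := rfl

theorem average_apply_of_mem_invariants (ρ : GModuleStructure k A V) {I : A →ₗ[k] k}
    (hI1 : I 1 = 1) {v : V} (hv : v ∈ ρ.invariants) : ρ.average I v = v := by
  rw [average_apply, mem_invariants.1 hv]
  simp [hI1]

theorem IsHom.map_average {ρ : GModuleStructure k A V} {σ : GModuleStructure k A W}
    {φ : V →ₗ[k] W} (h : IsHom ρ σ φ) (I : A →ₗ[k] k) (v : V) :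
    σ.average I (φ v) = φ (ρ.average I v) := by
  rw [average_apply, average_apply, isHom_iff.1 h]
  induction ρ.coact v using TensorProduct.induction_on with
  | zero => simp
  | tmul w a => simp
  | add x y hx hy => simp only [map_add, hx, hy]

theorem lTensor_smulRight_one_coact (ρ : GModuleStructure k A V) (I : A →ₗ[k] k) (v : V) :
    (I.smulRight (1 : A)).lTensor V (ρ.coact v) = ρ.average I v ⊗ₜ[k] (1 : A) := by
  rw [average_apply]
  induction ρ.coact v using TensorProduct.induction_on with
  | zero => simp
  | tmul w a => simp [TensorProduct.smul_tmul']
  | add x y hx hy => simp only [map_add, TensorProduct.add_tmul, hx, hy]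

theorem average_mem_invariants (ρ : GModuleStructure k A V) {I : A →ₗ[k] k}
    (hI : IsHom (regular k A) (trivial k A k) I) (hI1 : I 1 = 1) (v : V) :
    ρ.average I v ∈ ρ.invariants := by
  let F : A ⊗[k] A →ₗ[k] A := (TensorProduct.rid k A).toLinearMap ∘ₗ I.lTensor A
  have hF : F ∘ₗ Coalgebra.comul = I.smulRight (1 : A) :=
    LinearMap.ext (rid_lTensor_comul_of_isHom hI hI1)
  have h : ∀ y : V ⊗[k] A, ρ.coact (TensorProduct.rid k V (I.lTensor V y)) =
      F.lTensor V (TensorProduct.assoc k V A A (ρ.coact.rTensor A y)) := by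
    intro y
    induction y using TensorProduct.induction_on with
    | zero => simp
    | tmul w a =>
      simp only [LinearMap.rTensor_tmul, LinearMap.lTensor_tmul, TensorProduct.rid_tmul, map_smul]
      induction ρ.coact w using TensorProduct.induction_on with
      | zero => simp
      | tmul u b => simp [F]
      | add x y hx hy => simp only [map_add, TensorProduct.add_tmul, smul_add, hx, hy]
    | add x y hx hy => simp only [map_add, hx, hy]
  rw [mem_invariants, ← lTensor_smulRight_one_coact, average_apply, h, ρ.coassoc_apply,
    ← LinearMap.lTensor_comp_apply, hF]

theorem rTensor_average_coact (ρ : GModuleStructure k A V) {I : A →ₗ[k] k}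
    (hI : IsHom (regular k A) (trivial k A k) I) (v : V) :
    (ρ.average I).rTensor A (ρ.coact v) = ρ.average I v ⊗ₜ[k] (1 : A) := by
  let F : A ⊗[k] A →ₗ[k] A := (TensorProduct.lid k A).toLinearMap ∘ₗ I.rTensor A
  have hF : F ∘ₗ Coalgebra.comul = I.smulRight (1 : A) :=
    LinearMap.ext (lid_rTensor_comul_of_isHom hI)
  have h : ∀ y : V ⊗[k] A, (ρ.average I).rTensor A y =
      F.lTensor V (TensorProduct.assoc k V A A (ρ.coact.rTensor A y)) := by
    intro y
    induction y using TensorProduct.induction_on with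
    | zero => simp
    | tmul w a =>
      simp only [LinearMap.rTensor_tmul, average_apply]
      induction ρ.coact w using TensorProduct.induction_on with
      | zero => simp
      | tmul u b => simp [F, TensorProduct.smul_tmul]
      | add x y hx hy => simp only [map_add, TensorProduct.add_tmul, hx, hy]
    | add x y hx hy => simp only [map_add, hx, hy]
  rw [h, ρ.coassoc_apply, ← LinearMap.lTensor_comp_apply, hF, lTensor_smulRight_one_coact]

end

end GModuleStructure

/-- Averaging against a normalised invariant integral is a functorial Reynolds operator. -/
noncomputable def FunctorialReynoldsOperator.ofIntegral {k A : Type u} [CommRing k] [CommRing A]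
    [HopfAlgebra k A] [Module.Flat k A] (I : A →ₗ[k] k)
    (hI : IsHom (regular k A) (trivial k A k) I) (hI1 : I 1 = 1) :
    FunctorialReynoldsOperator k A where
  op V _ _ ρ := (ρ.average I).codRestrict ρ.invariants (ρ.average_mem_invariants hI hI1)
  isReynolds V _ _ ρ := by
    have hid : ∀ v : ρ.invariants, (ρ.average I).codRestrict ρ.invariants
        (ρ.average_mem_invariants hI hI1) (v : V) = v := fun v =>
      Subtype.ext (ρ.average_apply_of_mem_invariants hI1 v.2)
    refine ⟨isHom_iff.2 fun v => ?_, LinearMap.range_eq_top.2 fun v => ⟨v, hid v⟩, hid⟩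
    -- Flatness of `k[G]` lets the equation be checked in `V ⊗ k[G]` instead of `V^G ⊗ k[G]`.
    apply rTensor_subtype_injective A ρ.invariants
    rw [← LinearMap.rTensor_comp_apply, LinearMap.subtype_comp_codRestrict,
      rTensor_average_coact ρ hI]
    rfl
  natural V W _ _ _ _ ρ σ φ h v := h.map_average I v

theorem isCompl_range_algebraLinearMap_ker {k A : Type*} [CommRing k] [CommRing A] [Algebra k A]
    {I : A →ₗ[k] k} (hI1 : I 1 = 1) :
    IsCompl (LinearMap.range (Algebra.linearMap k A)) (LinearMap.ker I) := by
  have hI : ∀ t, I (algebraMap k A t) = t := fun t => by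
    rw [Algebra.algebraMap_eq_smul_one, map_smul, hI1, smul_eq_mul, mul_one]
  refine ⟨Submodule.disjoint_def.2 ?_, codisjoint_iff.2 (eq_top_iff.2 fun a _ => ?_)⟩
  · rintro _ ⟨t, rfl⟩ ht
    rw [LinearMap.mem_ker, Algebra.linearMap_apply, hI] at ht
    rw [ht, map_zero]
  · refine Submodule.mem_sup.2 ⟨algebraMap k A (I a), ⟨I a, rfl⟩, a - algebraMap k A (I a), ?_,
      add_sub_cancel _ _⟩
    rw [LinearMap.mem_ker, map_sub, hI, sub_self]

theorem isTranslationStable_ker {k A : Type u} [CommRing k] [CommRing A] [HopfAlgebra k A]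
    [Module.Flat k A] {I : A →ₗ[k] k} (hI : IsHom (regular k A) (trivial k A k) I)
    (hI1 : I 1 = 1) : IsTranslationStable k A (LinearMap.ker I) := by
  intro p hp
  constructor
  · exact hI.isStable_ker p hp
  · refine (Module.Flat.lTensor_exact A (LinearMap.exact_subtype_ker_map I) _).1 ?_
    apply (TensorProduct.rid k A).injective
    rw [rid_lTensor_comul_of_isHom hI hI1, LinearMap.mem_ker.1 hp, zero_smul, map_zero]

theorem theorem3p8 (k A : Type u) [CommRing k] [CommRing A] [HopfAlgebra k A]
    [Algebra.Smooth k A] :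
    (Nonempty (FunctorialReynoldsOperator k A) → IsLinearlyReductive k A) ∧
    (IsDedekindDomain k → IsLinearlyReductive k A →
      Nonempty (FunctorialReynoldsOperator k A) ∧
      ∃ P : Submodule k A, IsCompl (LinearMap.range (Algebra.linearMap k A)) P ∧
        IsTranslationStable k A P) := by
  refine ⟨fun ⟨R⟩ => R.isLinearlyReductive, fun _ hred => ?_⟩
  obtain ⟨I, hI, hI1⟩ := exists_regular_isHom_apply_one_eq_one hred
  exact ⟨⟨.ofIntegral I hI hI1⟩, LinearMap.ker I, isCompl_range_algebraLinearMap_ker hI1,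
    isTranslationStable_ker hI hI1⟩
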